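/- Let $\tau(n)$ be Ramanujan's tau-function, defined by $$\Delta(z)=q\prod_{n\ge 1}(1-q^n)^{24}=\sum_{n\ge 1}\tau(n)q^n,\qquad q=e^{2\pi i z},\ \operatorname{Im} z>0,$$ and let $\sigma_k(n)=\sum_{d\mid n}d^k$. Then for every integer $n\ge 1$, $$\text{(i)}\quad \tau(n)=-\frac{91}{600}\sigma_{11}(n)+\frac{691}{600}\sigma_3(n)+\frac{4\cdot 691}{5n}\sum_{m=1}^{n-1}m\,\sigma_3(m)\,\sigma_7(n-m),$$ $$\text{(ii)}\quad \tau(n)=-\frac{91}{600}\sigma_{11}(n)+\frac{691}{600}\sigma_7(n)+\frac{2\cdot 691}{5n}\sum_{m=1}^{n-1}(n-m)\,\sigma_3(m)\,\sigma_7(n-m).$$ -/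

import Mathlib

/-- Ramanujan's tau-function: `τ(n)` is the `n`-th Fourier coefficient of the cusp form
`Δ(z) = q ∏_{n ≥ 1} (1 - q ^ n) ^ 24`, `q = e ^ (2 π i z)`, of weight 12 for `SL₂(ℤ)`,
that is, the `n`-th coefficient of its `q`-expansion (see `hasSum_ramanujanTau`). -/
noncomputable def ramanujanTau (n : ℕ) : ℂ :=
  (UpperHalfPlane.qExpansion 1 ModularForm.discriminant).coeff n

/-- `∑ τ(n) q ^ n` converges to `q ∏_{n ≥ 1} (1 - q ^ n) ^ 24` on the upper half-plane, where
`q = e ^ (2 π i z)`. -/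
theorem hasSum_ramanujanTau (z : UpperHalfPlane) :
    HasSum (fun n : ℕ => ramanujanTau n * Complex.exp (2 * Real.pi * Complex.I * z) ^ n)
      (Complex.exp (2 * Real.pi * Complex.I * z) *
        ∏' n : ℕ, (1 - Complex.exp (2 * Real.pi * Complex.I * z) ^ (n + 1)) ^ 24) := by
  have hq : Function.Periodic.qParam 1 (z : ℂ) = Complex.exp (2 * Real.pi * Complex.I * z) := by
    simp [Function.Periodic.qParam]
  have h := ModularForm.hasSum_qExpansion (f := CuspForm.discriminant) one_pos
    (by simp) z
  rw [CuspForm.coe_discriminant, ModularForm.discriminant_eq_q_prod] at h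
  simpa only [ModularForm.eta_q, hq, smul_eq_mul, ramanujanTau] using h

open UpperHalfPlane ModularForm EisensteinSeries MatrixGroups

/-! There are no nonzero cusp forms of weight below 12, and those of weight 12 are spanned by Δ.
Hence E₄² = E₈ and E₄E₈ = E₁₂ + cΔ. Writing ' for q d/dq, both E₄'E₈ and E₄E₈' are then multiples of
E₄²E₄', namely 1/3 and 2/3 of (E₄³)' = (E₄E₈)'. The `n`-th coefficients of these two equalities are
(i) and (ii): the products give the convolution sums, and (E₄E₈)' gives n times a combination of
σ₁₁(n) and τ(n). -/

/-- The `q`-expansion of the normalised Eisenstein series of weight `k`. -/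
noncomputable def eisensteinQExp {k : ℕ} (hk : 3 ≤ k) : PowerSeries ℂ :=
  qExpansion 1 (E hk)

/-- A level one modular form of weight `k < 12` with vanishing constant term has zero
`q`-expansion. -/
theorem qExpansion_eq_zero_of_weight_lt_twelve {k : ℤ} (hk : k < 12) (f : ModularForm 𝒮ℒ k)
    (hf : (qExpansion 1 f).coeff 0 = 0) : qExpansion 1 f = 0 := by
  obtain ⟨g, rfl⟩ := (isCuspForm_iff_coeffZero_eq_zero f).mpr hf
  have hg : g = 0 := rank_zero_iff_forall_zero.mp (CuspForm.rank_eq_zero_of_weight_lt_twelve hk) g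
  rw [hg, map_zero]
  exact qExpansion_zero _

/-- A level one modular form of weight `12` with vanishing constant term has `q`-expansion
proportional to that of the discriminant. -/
theorem qExpansion_eq_smul_discriminant (f : ModularForm 𝒮ℒ 12)
    (hf : (qExpansion 1 f).coeff 0 = 0) :
    qExpansion 1 f = (qExpansion 1 f).coeff 1 • qExpansion 1 discriminant := by
  obtain ⟨g, rfl⟩ := (isCuspForm_iff_coeffZero_eq_zero f).mpr hf
  obtain ⟨c, rfl⟩ := CuspForm.exists_smul_discriminant_of_weight_eq_twelve g
  have h : qExpansion 1 (CuspForm.toModularFormₗ (c • CuspForm.discriminant)) =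
      c • qExpansion 1 discriminant :=
    ModularForm.qExpansion_smul one_pos one_mem_strictPeriods_SL c CuspForm.discriminant
  rw [h, PowerSeries.coeff_smul, discriminant_qExpansion_coeff_one, smul_eq_mul, mul_one]

/-- Here and in weights 8 and 12 the constant is -2k/B_k; the 691 comes from B₁₂. -/
theorem eisensteinQExp_coeff_four (m : ℕ) :
    (eisensteinQExp (k := 4) (by norm_num)).coeff m =
      if m = 0 then 1 else 240 * (ArithmeticFunction.sigma 3 m : ℂ) := by
  rw [eisensteinQExp, E_qExpansion_coeff _ ⟨2, rfl⟩, show bernoulli 4 = -1 / 30 by decide +kernel]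
  norm_num

theorem eisensteinQExp_coeff_eight (m : ℕ) :
    (eisensteinQExp (k := 8) (by norm_num)).coeff m =
      if m = 0 then 1 else 480 * (ArithmeticFunction.sigma 7 m : ℂ) := by
  rw [eisensteinQExp, E_qExpansion_coeff _ ⟨4, rfl⟩, show bernoulli 8 = -1 / 30 by decide +kernel]
  norm_num

theorem eisensteinQExp_coeff_twelve (m : ℕ) :
    (eisensteinQExp (k := 12) (by norm_num)).coeff m =
      if m = 0 then 1 else 65520 / 691 * (ArithmeticFunction.sigma 11 m : ℂ) := by
  rw [eisensteinQExp, E_qExpansion_coeff _ ⟨6, rfl⟩,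
    show bernoulli 12 = -691 / 2730 by decide +kernel]
  norm_num

/-- `E₄² = E₈`. -/
theorem eisensteinQExp_four_mul_four :
    eisensteinQExp (k := 4) (by norm_num) * eisensteinQExp (k := 4) (by norm_num) =
      eisensteinQExp (k := 8) (by norm_num) := by
  let f : ModularForm 𝒮ℒ 8 := ModularForm.mcast (by norm_num)
    ((E (k := 4) (by norm_num)).mul (E (k := 4) (by norm_num))) - E (k := 8) (by norm_num)
  have hq : qExpansion 1 f = eisensteinQExp (k := 4) (by norm_num) *
      eisensteinQExp (k := 4) (by norm_num) - eisensteinQExp (k := 8) (by norm_num) := by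
    simp only [f, eisensteinQExp, FunLike.coe_sub, coe_mcast,
      ModularForm.qExpansion_sub one_pos one_mem_strictPeriods_SL,
      ModularForm.qExpansion_mul one_pos one_mem_strictPeriods_SL]
  rw [← sub_eq_zero, ← hq]
  refine qExpansion_eq_zero_of_weight_lt_twelve (by norm_num) f ?_
  rw [hq, map_sub, PowerSeries.coeff_mul]
  simp only [Finset.Nat.antidiagonal_zero, Finset.sum_singleton, eisensteinQExp_coeff_four,
    eisensteinQExp_coeff_eight]
  norm_num

/-- `E₄ E₈ = E₁₂ + (432000 / 691) Δ`. -/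
theorem eisensteinQExp_four_mul_eight :
    eisensteinQExp (k := 4) (by norm_num) * eisensteinQExp (k := 8) (by norm_num) =
      eisensteinQExp (k := 12) (by norm_num) +
        (432000 / 691 : ℂ) • qExpansion 1 discriminant := by
  let f : ModularForm 𝒮ℒ 12 := ModularForm.mcast (by norm_num)
    ((E (k := 4) (by norm_num)).mul (E (k := 8) (by norm_num))) - E (k := 12) (by norm_num)
  have hq : qExpansion 1 f = eisensteinQExp (k := 4) (by norm_num) *
      eisensteinQExp (k := 8) (by norm_num) - eisensteinQExp (k := 12) (by norm_num) := by
    simp only [f, eisensteinQExp, FunLike.coe_sub, coe_mcast,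
      ModularForm.qExpansion_sub one_pos one_mem_strictPeriods_SL,
      ModularForm.qExpansion_mul one_pos one_mem_strictPeriods_SL]
  have h := qExpansion_eq_smul_discriminant f (by
    rw [hq, map_sub, PowerSeries.coeff_mul]
    simp only [Finset.Nat.antidiagonal_zero, Finset.sum_singleton, eisensteinQExp_coeff_four,
      eisensteinQExp_coeff_eight, eisensteinQExp_coeff_twelve]
    norm_num)
  -- 432000/691 = 240 + 480 - 65520/691.
  have h1 : (qExpansion 1 f).coeff 1 = 432000 / 691 := by
    rw [hq, map_sub, PowerSeries.coeff_mul]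
    simp only [Finset.Nat.antidiagonal_succ, Finset.Nat.antidiagonal_zero, Finset.sum_cons,
      Finset.map_singleton, Finset.sum_singleton, eisensteinQExp_coeff_four,
      eisensteinQExp_coeff_eight, eisensteinQExp_coeff_twelve]
    norm_num
  rw [h1, hq] at h
  rw [← h, add_sub_cancel]

/-- Isolating the extreme terms of a coefficient of a Cauchy product. -/
theorem PowerSeries.coeff_mul_eq_add_sum_Ico {R : Type*} [Semiring R] (f g : PowerSeries R)
    {n : ℕ} (hn : 1 ≤ n) :
    (f * g).coeff n = f.coeff 0 * g.coeff n + f.coeff n * g.coeff 0 +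
      ∑ m ∈ Finset.Ico 1 n, f.coeff m * g.coeff (n - m) := by
  rw [PowerSeries.coeff_mul, Finset.Nat.sum_antidiagonal_eq_sum_range_succ_mk,
    Finset.sum_range_succ, Finset.range_eq_Ico, Finset.sum_eq_sum_Ico_succ_bot (by omega)]
  simp only [Nat.sub_zero, Nat.sub_self, zero_add]
  abel

/-- The Euler derivative `q d/dq` of a power series. -/
noncomputable def eulerDeriv (f : PowerSeries ℂ) : PowerSeries ℂ :=
  PowerSeries.X * PowerSeries.derivative ℂ f

theorem coeff_eulerDeriv (f : PowerSeries ℂ) (n : ℕ) :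
    (eulerDeriv f).coeff n = n * f.coeff n := by
  cases n with
  | zero => simp [eulerDeriv]
  | succ n =>
    rw [eulerDeriv, PowerSeries.coeff_succ_X_mul, PowerSeries.coeff_derivative]
    push_cast
    ring

theorem eulerDeriv_mul (f g : PowerSeries ℂ) :
    eulerDeriv (f * g) = f * eulerDeriv g + eulerDeriv f * g := by
  simp only [eulerDeriv, Derivation.leibniz, smul_eq_mul]
  ring

theorem coeff_eulerDeriv_four_mul_eight {n : ℕ} (hn : 1 ≤ n) :
    (eulerDeriv (eisensteinQExp (k := 4) (by norm_num) *
      eisensteinQExp (k := 8) (by norm_num))).coeff n =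
      n * (65520 / 691 * (ArithmeticFunction.sigma 11 n : ℂ) +
        432000 / 691 * ramanujanTau n) := by
  rw [coeff_eulerDeriv, eisensteinQExp_four_mul_eight, map_add, PowerSeries.coeff_smul,
    eisensteinQExp_coeff_twelve, if_neg (by omega), smul_eq_mul, ramanujanTau]

/-- `3 E₄' E₈ = (E₄ E₈)'`. -/
theorem three_mul_eulerDeriv_four_mul_eight :
    3 * (eulerDeriv (eisensteinQExp (k := 4) (by norm_num)) *
      eisensteinQExp (k := 8) (by norm_num)) =
    eulerDeriv (eisensteinQExp (k := 4) (by norm_num) *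
      eisensteinQExp (k := 8) (by norm_num)) := by
  -- With E₈ = E₄², both sides equal 3E₄²E₄' by the Leibniz rule.
  rw [← eisensteinQExp_four_mul_four]
  simp only [eulerDeriv_mul]
  ring

/-- `3 E₄ E₈' = 2 (E₄ E₈)'`. -/
theorem three_mul_four_mul_eulerDeriv_eight :
    3 * (eisensteinQExp (k := 4) (by norm_num) *
      eulerDeriv (eisensteinQExp (k := 8) (by norm_num))) =
    2 * eulerDeriv (eisensteinQExp (k := 4) (by norm_num) *
      eisensteinQExp (k := 8) (by norm_num)) := by
  rw [← eisensteinQExp_four_mul_four]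
  simp only [eulerDeriv_mul]
  ring

/-- E₄' has no constant term, so of the two extreme terms only the one with σ₃(n) survives; 115200 =
240 · 480. -/
theorem coeff_eulerDeriv_four_mul_eight_eq_sum {n : ℕ} (hn : 1 ≤ n) :
    (eulerDeriv (eisensteinQExp (k := 4) (by norm_num)) *
      eisensteinQExp (k := 8) (by norm_num)).coeff n =
    240 * n * (ArithmeticFunction.sigma 3 n : ℂ) + 115200 * ∑ m ∈ Finset.Ico 1 n,
      (m : ℂ) * (ArithmeticFunction.sigma 3 m : ℂ) *
        (ArithmeticFunction.sigma 7 (n - m) : ℂ) := by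
  rw [PowerSeries.coeff_mul_eq_add_sum_Ico _ _ hn, Finset.mul_sum]
  simp only [coeff_eulerDeriv, eisensteinQExp_coeff_four, eisensteinQExp_coeff_eight,
    if_neg (show n ≠ 0 by omega), if_true]
  congr 1
  · push_cast
    ring
  · refine Finset.sum_congr rfl fun m hm ↦ ?_
    rw [Finset.mem_Ico] at hm
    rw [if_neg (by omega), if_neg (by omega)]
    ring

/-- Now E₈' lacks a constant term, so the surviving extreme term is the one with σ₇(n). -/
theorem coeff_four_mul_eulerDeriv_eight_eq_sum {n : ℕ} (hn : 1 ≤ n) :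
    (eisensteinQExp (k := 4) (by norm_num) *
      eulerDeriv (eisensteinQExp (k := 8) (by norm_num))).coeff n =
    480 * n * (ArithmeticFunction.sigma 7 n : ℂ) + 115200 * ∑ m ∈ Finset.Ico 1 n,
      ((n : ℂ) - (m : ℂ)) * (ArithmeticFunction.sigma 3 m : ℂ) *
        (ArithmeticFunction.sigma 7 (n - m) : ℂ) := by
  rw [PowerSeries.coeff_mul_eq_add_sum_Ico _ _ hn, Finset.mul_sum]
  simp only [coeff_eulerDeriv, eisensteinQExp_coeff_four, eisensteinQExp_coeff_eight,
    if_neg (show n ≠ 0 by omega), if_true]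
  congr 1
  · push_cast
    ring
  · refine Finset.sum_congr rfl fun m hm ↦ ?_
    rw [Finset.mem_Ico] at hm
    rw [if_neg (by omega), if_neg (by omega), Nat.cast_sub (by omega)]
    ring

theorem coeff_ofNat_mul (a n : ℕ) [a.AtLeastTwo] (f : PowerSeries ℂ) :
    ((OfNat.ofNat a : PowerSeries ℂ) * f).coeff n = (OfNat.ofNat a : ℂ) * f.coeff n := by
  rw [← map_ofNat (PowerSeries.C (R := ℂ)) a, PowerSeries.coeff_C_mul]

theorem theorem2p4 (n : ℕ) (hn : 1 ≤ n) :
    (ramanujanTau n = -(91 / 600) * (ArithmeticFunction.sigma 11 n : ℂ)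
        + 691 / 600 * (ArithmeticFunction.sigma 3 n : ℂ)
        + 4 * 691 / (5 * (n : ℂ)) * ∑ m ∈ Finset.Ico 1 n,
            (m : ℂ) * (ArithmeticFunction.sigma 3 m : ℂ)
              * (ArithmeticFunction.sigma 7 (n - m) : ℂ)) ∧
    (ramanujanTau n = -(91 / 600) * (ArithmeticFunction.sigma 11 n : ℂ)
        + 691 / 600 * (ArithmeticFunction.sigma 7 n : ℂ)
        + 2 * 691 / (5 * (n : ℂ)) * ∑ m ∈ Finset.Ico 1 n,
            ((n : ℂ) - (m : ℂ)) * (ArithmeticFunction.sigma 3 m : ℂ)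
              * (ArithmeticFunction.sigma 7 (n - m) : ℂ)) := by
  have hn0 : (n : ℂ) ≠ 0 := Nat.cast_ne_zero.mpr (by omega)
  have h1 := congrArg (PowerSeries.coeff n) three_mul_eulerDeriv_four_mul_eight
  have h2 := congrArg (PowerSeries.coeff n) three_mul_four_mul_eulerDeriv_eight
  rw [coeff_ofNat_mul, coeff_eulerDeriv_four_mul_eight hn,
    coeff_eulerDeriv_four_mul_eight_eq_sum hn] at h1
  rw [coeff_ofNat_mul, coeff_ofNat_mul, coeff_eulerDeriv_four_mul_eight hn,
    coeff_four_mul_eulerDeriv_eight_eq_sum hn] at h2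
  constructor
  · generalize (∑ m ∈ Finset.Ico 1 n, _ : ℂ) = S at h1 ⊢
    field_simp
    -- The factor turns the τ(n)-coefficient -432000n/691 into 3000n, the cleared denominator 600 ·
    -- 5n; in (ii) that coefficient is doubled, so the factor is halved.
    linear_combination (-691 / 144 : ℂ) * h1
  · generalize (∑ m ∈ Finset.Ico 1 n, _ : ℂ) = S at h2 ⊢
    field_simp
    linear_combination (-691 / 288 : ℂ) * h2
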